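/- Theorem (Moser method for Poisson manifolds). Let $M$ be a (finite-dimensional, Hausdorff, smooth) manifold without boundary and let $J\subseteq\mathbb{R}$ be an interval containing $0$. Let $(\pi_t)_{t\in J}$ be a smooth family of Poisson structures on $M$, $(\omega_t)_{t\in J}$ a smooth family of closed 2-forms, and $(a_t)_{t\in J}$ a smooth family of 1-forms on $M$. For a bivector field $\pi$ write $\pi^\sharp\colon T^*M\to TM$, $\mu\mapsto\pi(\mu,\cdot)$, and $\mathrm{Gr}(\pi)=\{\pi^\sharp(\mu)+\mu\}\subseteq TM\oplus T^*M$; for a 2-form $\omega$ write $\mathcal{R}_\omega(v+\mu)=v+\mu+\iota_v\omega$. Suppose that for all $t\in J$ $$\pi_t=(\pi_0)^{\omega_t},\ \text{ i.e. }\ \mathcal{R}_{\omega_t}(\mathrm{Gr}(\pi_0))=\mathrm{Gr}(\pi_t),\qquad\text{and}\qquad \frac{d\omega_t}{dt}=-\,\mathrm{d}a_t .$$ Let $X_t=\pi_t^\sharp(a_t)$, and let $\Phi_t$ be the (possibly only local) flow of the time-dependent vector field $X_t$, starting at time $0$, with the convention $$\frac{d}{dt}(\Phi_t)_*=(\Phi_t)_*\circ\mathcal{L}_{X_t}\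 \text{ on functions},\qquad (\Phi_t)_*f=f\circ\Phi_t^{-1};$$ that is, $t\mapsto\Phi_t^{-1}(y)$ is the solution of $\dot x=X_t(x)$, $x(0)=y$. Here $\Phi_t$ is a diffeomorphism between open subsets of $M$, its target is contained in that of $\Phi_s$ for every $s$ between $0$ and $t$, and $\Phi_t^{-1}(y)$ depends smoothly on $(t,y)$; if $X_t$ is complete, $\Phi_t$ may be taken to be a diffeomorphism of $M$. Then for all $t\in J$, on the target of $\Phi_t$, $$(\Phi_t)_*\pi_t=\pi_0 .$$ -/

import Mathlib

open Set
open scoped Manifold ContDiff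

noncomputable section

namespace PoissonMoser

/-! ### Linear algebra on one tangent space -/

section Linear

variable {V : Type*} [AddCommGroup V] [Module ℝ V] [TopologicalSpace V]

/-- The contraction `ι_v Ω = Ω(v, ·)` of a 2-form. -/
def contract (Ω : V [⋀^Fin 2]→L[ℝ] ℝ) (v : V) : V →L[ℝ] ℝ :=
  Ω.toContinuousMultilinearMap.toContinuousLinearMap ![v, 0] 1

theorem contract_apply (Ω : V [⋀^Fin 2]→L[ℝ] ℝ) (v w : V) :
    contract Ω v w = Ω ![v, w] := by
  change Ω (Function.update ![v, 0] 1 w) = Ω ![v, w]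
  congr 1
  ext i
  fin_cases i <;> rfl

variable [IsTopologicalAddGroup V] [ContinuousSMul ℝ V]
  {W : Type*} [AddCommGroup W] [Module ℝ W] [TopologicalSpace W]
  [IsTopologicalAddGroup W] [ContinuousSMul ℝ W]

variable (V) in
/-- A bivector `π` on a finite-dimensional space `V`, i.e. a skew-symmetric bilinear form on the
dual space, given through the map `π♯ : V* → V`, `μ ↦ π(μ, ·)`. The form itself is
`π(μ, ν) = ⟨ν, π♯ μ⟩`, see `Bivector.pair`. -/
structure Bivector where
  sharp : (V →L[ℝ] ℝ) →L[ℝ] V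
  skew : ∀ μ ν : V →L[ℝ] ℝ, ν (sharp μ) = -μ (sharp ν)

/-- The value `π(μ, ν)` of the skew-symmetric form. -/
def Bivector.pair (π : Bivector V) (μ ν : V →L[ℝ] ℝ) : ℝ := ν (π.sharp μ)

/-- The image of a bivector under a linear map `A`: `(A π)(μ, ν) = π(A* μ, A* ν)`,
so that `(A π)♯ = A ∘ π♯ ∘ A*`. -/
def Bivector.map (A : V →L[ℝ] W) (π : Bivector V) : Bivector W where
  sharp := A ∘L π.sharp ∘L ContinuousLinearMap.precomp ℝ A
  skew μ ν := π.skew (μ ∘L A) (ν ∘L A)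

/-- The graph `Gr(π) = {π♯ μ + μ} ⊆ V ⊕ V*`. -/
def Bivector.graph (π : Bivector V) : Set (V × (V →L[ℝ] ℝ)) :=
  range fun μ => (π.sharp μ, μ)

/-- An alternating form of degree one, seen as a covector. -/
def covector (α : V [⋀^Fin 1]→L[ℝ] ℝ) : V →L[ℝ] ℝ :=
  (ContinuousAlternatingMap.ofSubsingleton ℝ V ℝ (0 : Fin 1)).symm α

/-- The transformation `R_Ω : V ⊕ V* → V ⊕ V*`, `v + μ ↦ v + μ + ι_v Ω`. -/
def gaugeMap (Ω : V [⋀^Fin 2]→L[ℝ] ℝ) (x : V × (V →L[ℝ] ℝ)) : V × (V →L[ℝ] ℝ) :=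
  (x.1, x.2 + contract Ω x.1)

end Linear

/-! ### Differential forms and bivector fields on a manifold -/

section Fields

variable (E : Type*) [NormedAddCommGroup E] [NormedSpace ℝ E]
  (M : Type*) [TopologicalSpace M] [ChartedSpace E M]

/-- Differential forms of degree `n` (no smoothness required yet). -/
abbrev DiffForm (n : ℕ) : Type _ := (x : M) → TangentSpace 𝓘(ℝ, E) x [⋀^Fin n]→L[ℝ] ℝ

/-- Bivector fields (no smoothness required yet). -/
abbrev BivectorField : Type _ := (x : M) → Bivector (TangentSpace 𝓘(ℝ, E) x)

/-- Vector fields (no smoothness required yet). -/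
abbrev VecField : Type _ := (x : M) → TangentSpace 𝓘(ℝ, E) x

variable {E M}

/-- The expression of a differential form in the chart around `x₀`: its pull-back under the
inverse of the chart. Only its values on the target of the chart are meaningful. -/
def DiffForm.inChart {n : ℕ} (Ω : DiffForm E M n) (x₀ : M) (y : E) : E [⋀^Fin n]→L[ℝ] ℝ :=
  (Ω ((extChartAt 𝓘(ℝ, E) x₀).symm y)).compContinuousLinearMap
    (mfderiv 𝓘(ℝ, E) 𝓘(ℝ, E) (extChartAt 𝓘(ℝ, E) x₀).symm y)

/-- The exterior derivative, computed at `x` in the chart around `x`. -/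
def DiffForm.d {n : ℕ} (Ω : DiffForm E M n) : DiffForm E M (n + 1) := fun x =>
  (extDeriv (DiffForm.inChart Ω x) (extChartAt 𝓘(ℝ, E) x x)).compContinuousLinearMap
    (mfderiv 𝓘(ℝ, E) 𝓘(ℝ, E) (extChartAt 𝓘(ℝ, E) x) x)

/-- The expression `y ↦ π♯` of a bivector field in the chart around `x₀`: its push-forward under
the chart. Only its values on the target of the chart are meaningful. -/
def BivectorField.inChart (π : BivectorField E M) (x₀ : M) (y : E) : (E →L[ℝ] ℝ) →L[ℝ] E :=
  ((π ((extChartAt 𝓘(ℝ, E) x₀).symm y)).map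
    (mfderiv 𝓘(ℝ, E) 𝓘(ℝ, E) (extChartAt 𝓘(ℝ, E) x₀)
      ((extChartAt 𝓘(ℝ, E) x₀).symm y)) : Bivector E).sharp

/-- `(Ω_t)`, `t ∈ J`, is a smooth family of differential forms: its coefficients in charts are
smooth functions of `t` and of the point jointly. -/
def SmoothFormFamily {n : ℕ} (J : Set ℝ) (Ω : ℝ → DiffForm E M n) : Prop :=
  ∀ x₀ : M, ContDiffOn ℝ ∞ (fun p : ℝ × E => DiffForm.inChart (Ω p.1) x₀ p.2)
    (J ×ˢ (extChartAt 𝓘(ℝ, E) x₀).target)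

/-- `(π_t)`, `t ∈ J`, is a smooth family of bivector fields: its coefficients in charts are
smooth functions of `t` and of the point jointly. -/
def SmoothBivectorFamily (J : Set ℝ) (π : ℝ → BivectorField E M) : Prop :=
  ∀ x₀ : M, ContDiffOn ℝ ∞ (fun p : ℝ × E => BivectorField.inChart (π p.1) x₀ p.2)
    (J ×ˢ (extChartAt 𝓘(ℝ, E) x₀).target)

/-- The differential of a real function at a point, as a covector. -/
def differential (f : M → ℝ) (x : M) : TangentSpace 𝓘(ℝ, E) x →L[ℝ] ℝ :=
  mfderiv 𝓘(ℝ, E) 𝓘(ℝ, ℝ) f x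

/-- The bracket `{f, g} = π(df, dg)`. -/
def bracket (π : BivectorField E M) (f g : M → ℝ) : M → ℝ := fun x =>
  (π x).pair (differential f x) (differential g x)

/-- The Jacobi identity for the bracket of a (smooth) bivector field `π` on smooth functions:
`π` is a Poisson structure. -/
def IsPoisson (π : BivectorField E M) : Prop :=
  ∀ f g h : M → ℝ, ContMDiff 𝓘(ℝ, E) 𝓘(ℝ, ℝ) ∞ f → ContMDiff 𝓘(ℝ, E) 𝓘(ℝ, ℝ) ∞ g →
    ContMDiff 𝓘(ℝ, E) 𝓘(ℝ, ℝ) ∞ h → ∀ x : M,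
      bracket π f (bracket π g h) x + bracket π g (bracket π h f) x
        + bracket π h (bracket π f g) x = 0

/-- `π' = π^Ω`, that is, `R_Ω(Gr(π)) = Gr(π')`. -/
def IsGaugeTransform (π : BivectorField E M) (Ω : DiffForm E M 2) (π' : BivectorField E M) :
    Prop :=
  ∀ x : M, gaugeMap (Ω x) '' (π x).graph = (π' x).graph

/-- The family `Φ_t : source → target`, `t ∈ J`, of diffeomorphisms between open subsets of `M` is
a (local) flow, starting at time `0`, of the time-dependent vector field `X_t`. The convention is
that `d/dt (Φ_t)_* f = (Φ_t)_* (X_t f)` on functions, where `(Φ_t)_* f = f ∘ Φ_t⁻¹`; so `Φ_t⁻¹(y)`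
is the solution at time `t` of the equation `dx/dt = X_t(x)` with `x(0) = y`. The target of `Φ_t`
is a set of initial values for which the solution exists up to time `t`; a global flow is the case
in which all sources and targets are all of `M`. -/
structure IsLocalFlow (J : Set ℝ) (X : ℝ → VecField E M) (Φ : ℝ → OpenPartialHomeomorph M M) :
    Prop where
  target_subset : ∀ t ∈ J, ∀ s ∈ uIcc 0 t, (Φ t).target ⊆ (Φ s).target
  zero : ∀ y ∈ (Φ 0).target, (Φ 0).symm y = y
  smooth : ∀ t ∈ J, ContMDiffOn 𝓘(ℝ, E) 𝓘(ℝ, E) ∞ (Φ t) (Φ t).source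
  smooth_symm : ContMDiffOn (𝓘(ℝ, ℝ).prod 𝓘(ℝ, E)) 𝓘(ℝ, E) ∞
    (fun p : ℝ × M => (Φ p.1).symm p.2) {p | p.1 ∈ J ∧ p.2 ∈ (Φ p.1).target}
  deriv : ∀ f : M → ℝ, ContMDiff 𝓘(ℝ, E) 𝓘(ℝ, ℝ) ∞ f → ∀ t ∈ J, ∀ y ∈ (Φ t).target,
    HasDerivWithinAt (fun s => f ((Φ s).symm y))
      (differential f ((Φ t).symm y) (X t ((Φ t).symm y)))
      {s | s ∈ J ∧ y ∈ (Φ s).target} t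

/-- `Φ_* π = π'`, where `Φ` is a diffeomorphism between open subsets of `M`, `Φ_* π = (TΦ)(π)`, and
the equality is one of bivector fields on the target of `Φ`. -/
def PushForwardEq (Φ : OpenPartialHomeomorph M M) (π π' : BivectorField E M) : Prop :=
  ∀ x ∈ Φ.source, (π x).map (mfderiv 𝓘(ℝ, E) 𝓘(ℝ, E) Φ x) = π' (Φ x)

end Fields

end PoissonMoser

end

/-! Since `(Φ s).symm` follows `X_s`, the derivative of `(Φ_s)_* π_s` in `s` is `(Φ_s)_*(dπ_s/ds +
L_{X_s} π_s)`, and the two terms cancel. Differentiating the gauge relation gives `dπ_s♯/ds = -π_s♯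
∘ (dΩ_s/ds) ∘ π_s♯ = π_s♯ ∘ da_s ∘ π_s♯` (`deriv_gauge_family`), while the Jacobi identity for `π_s`
gives `L_{π_s♯ a_s} π_s = -π_s♯ ∘ da_s ∘ π_s♯` (`lieDeriv_add_eq_zero`).

The computation is pointwise. Fix `y` in the target of `Φ_t` and two covectors at `y`; the value of
`(Φ_s)_* π_s` on them is a real function of `s` on the interval between `0` and `t`. Near a time
`s₀` it is read in the chart centred at `c = Φ_{s₀}⁻¹(y)`, where it becomes `C_s p_s C_s*`: here
`p_s` is `π_s` along the curve `Φ_s⁻¹(y)`, and `C_s` is the inverse of the derivative `B_s` of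
`Φ_s⁻¹`. The variational equation `B' = DX ∘ B` (`hasDerivWithinAt_fderiv_of_flow`) together with
the cancellation above makes the derivative vanish at `s₀` (`hasDerivWithinAt_transport_zero`,
`hasDerivWithinAt_pushPair`). So the function is constant, and at `s = 0` it is the value of `π_0`.
-/

open Set Filter Topology
open scoped Manifold ContDiff

noncomputable section

namespace PoissonMoser

/-! ### Calculus in a vector space: variational equation, Lie derivative of a bivector, gauge
families. -/

section Euclidean

variable {E : Type*} [NormedAddCommGroup E] [NormedSpace ℝ E]

/-- The derivative `B_s` of a flow with respect to the initial value satisfies the variational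
equation `dB_s/ds = DX ∘ B_s`. -/
theorem hasDerivWithinAt_fderiv_of_flow {I : Set ℝ} {V : Set E} {s₀ : ℝ} {z₀ : E}
    {ψ : ℝ × E → E} {X : E → E} (hI : UniqueDiffOn ℝ I) (hs₀ : s₀ ∈ I)
    (hs₀' : s₀ ∈ closure (interior I)) (hV : IsOpen V) (hz₀ : z₀ ∈ V)
    (hψ : ContDiffWithinAt ℝ 2 ψ (I ×ˢ V) (s₀, z₀))
    (hX : DifferentiableAt ℝ X (ψ (s₀, z₀)))
    (hflow : ∀ᶠ z in 𝓝 z₀, HasDerivWithinAt (fun s => ψ (s, z)) (X (ψ (s₀, z))) I s₀) :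
    HasDerivWithinAt (fun s => fderiv ℝ (fun z => ψ (s, z)) z₀)
      (fderiv ℝ X (ψ (s₀, z₀)) ∘L fderiv ℝ (fun z => ψ (s₀, z)) z₀) I s₀ := by
  have hS : UniqueDiffOn ℝ (I ×ˢ V) := hI.prod hV.uniqueDiffOn
  have hmem : (s₀, z₀) ∈ I ×ˢ V := ⟨hs₀, hz₀⟩
  have hmem' : (s₀, z₀) ∈ closure (interior (I ×ˢ V)) := by
    rw [interior_prod_eq, hV.interior_eq, closure_prod_eq]
    exact ⟨hs₀', subset_closure hz₀⟩
  -- Symmetry also holds at an endpoint of `I`, because such a point is a limit of interior points.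
  have hsymm : IsSymmSndFDerivWithinAt ℝ ψ (I ×ˢ V) (s₀, z₀) :=
    hψ.isSymmSndFDerivWithinAt (by simp) hS hmem' hmem
  have hD : HasFDerivWithinAt (fderivWithin ℝ ψ (I ×ˢ V))
      (fderivWithin ℝ (fderivWithin ℝ ψ (I ×ˢ V)) (I ×ˢ V) (s₀, z₀)) (I ×ˢ V) (s₀, z₀) :=
    ((hψ.fderivWithin_right hS (m := 1) (by norm_num) hmem).differentiableWithinAt
      (by norm_num)).hasFDerivWithinAt
  set D := fderivWithin ℝ ψ (I ×ˢ V) with hDdef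
  set D2 := fderivWithin ℝ D (I ×ˢ V) (s₀, z₀) with hD2
  have hdiff : ∀ᶠ p in 𝓝[I ×ˢ V] (s₀, z₀), HasFDerivWithinAt ψ (D p) (I ×ˢ V) p := by
    have := hψ.eventually (by simp)
    rw [insert_eq_of_mem hmem] at this
    filter_upwards [this] with p hp
    exact (hp.differentiableWithinAt (by norm_num)).hasFDerivWithinAt
  have hinr : ∀ (s : ℝ) (z : E), s ∈ I → z ∈ V → HasFDerivWithinAt ψ (D (s, z)) (I ×ˢ V) (s, z) →
      HasFDerivAt (fun z => ψ (s, z)) (D (s, z) ∘L ContinuousLinearMap.inr ℝ ℝ E) z := by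
    intro s z hs hz h
    have h1 : HasFDerivWithinAt (fun z : E => (s, z)) (ContinuousLinearMap.inr ℝ ℝ E) V z :=
      (hasFDerivAt_prodMk_right s z).hasFDerivWithinAt
    exact (h.comp z h1 (fun w hw => ⟨hs, hw⟩)).hasFDerivAt (hV.mem_nhds hz)
  have hleft : HasDerivWithinAt (fun s : ℝ => (s, z₀)) ((1 : ℝ), (0 : E)) I s₀ :=
    (hasDerivWithinAt_id s₀ I).prodMk (hasDerivWithinAt_const s₀ I z₀)
  have hright : HasFDerivWithinAt (fun z : E => (s₀, z)) (ContinuousLinearMap.inr ℝ ℝ E) V z₀ :=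
    (hasFDerivAt_prodMk_right s₀ z₀).hasFDerivWithinAt
  have htl : Tendsto (fun s : ℝ => (s, z₀)) (𝓝[I] s₀) (𝓝[I ×ˢ V] (s₀, z₀)) :=
    hleft.continuousWithinAt.tendsto_nhdsWithin (fun s hs => ⟨hs, hz₀⟩)
  have htr : Tendsto (fun z : E => (s₀, z)) (𝓝 z₀) (𝓝[I ×ˢ V] (s₀, z₀)) := by
    have := hright.continuousWithinAt.tendsto_nhdsWithin (t := I ×ˢ V) (fun z hz => ⟨hs₀, hz⟩)
    rwa [hV.nhdsWithin_eq hz₀] at this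
  -- the partial derivative in time is `X ∘ ψ`
  have htime : ∀ᶠ z in 𝓝 z₀, D (s₀, z) (1, 0) = X (ψ (s₀, z)) := by
    filter_upwards [hflow, htr.eventually hdiff, hV.mem_nhds hz₀] with z hz hz' hzV
    have hl : HasDerivWithinAt (fun s : ℝ => (s, z)) ((1 : ℝ), (0 : E)) I s₀ :=
      (hasDerivWithinAt_id s₀ I).prodMk (hasDerivWithinAt_const s₀ I z)
    exact (hI s₀ hs₀).eq_deriv _
      (hz'.comp_hasDerivWithinAt s₀ hl
        (fun s hs => (⟨hs, hzV⟩ : s ∈ I ∧ z ∈ V))) hz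
  have hspace₀ : HasFDerivAt (fun z => ψ (s₀, z)) (D (s₀, z₀) ∘L ContinuousLinearMap.inr ℝ ℝ E) z₀ :=
    hinr s₀ z₀ hs₀ hz₀ (hdiff.self_of_nhdsWithin hmem)
  -- Space derivative of the time derivative: differentiate `∂ψ/∂s = X ∘ ψ` in `z` at time `s₀`. The
  -- symmetry of `D2` then turns this into the time derivative of the space derivative.
  have hmixed : ∀ w : E, D2 (0, w) (1, 0)
      = fderiv ℝ X (ψ (s₀, z₀)) (fderiv ℝ (fun z => ψ (s₀, z)) z₀ w) := by
    intro w
    have h1 : HasFDerivAt (fun z => D (s₀, z)) (D2 ∘L ContinuousLinearMap.inr ℝ ℝ E) z₀ :=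
      (hD.comp z₀ hright (fun z hz => ⟨hs₀, hz⟩)).hasFDerivAt (hV.mem_nhds hz₀)
    have h2 := h1.clm_apply (hasFDerivAt_const ((1 : ℝ), (0 : E)) z₀)
    have h3 : HasFDerivAt (fun z => X (ψ (s₀, z))) _ z₀ :=
      HasFDerivAt.comp z₀ (g := X) hX.hasFDerivAt hspace₀
    have h4 := (h2.congr_of_eventuallyEq (htime.mono fun z hz => hz.symm)).unique h3
    have h5 := congrArg (fun L => L w) h4
    simpa [hspace₀.fderiv] using h5
  have hB : HasDerivWithinAt (fun s => D (s, z₀) ∘L ContinuousLinearMap.inr ℝ ℝ E)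
      (D2 (1, 0) ∘L ContinuousLinearMap.inr ℝ ℝ E) I s₀ := by
    have h1 := hD.comp_hasDerivWithinAt s₀ hleft
      (fun s hs => (⟨hs, hz₀⟩ : s ∈ I ∧ z₀ ∈ V))
    simpa using h1.clm_comp (hasDerivWithinAt_const s₀ I (ContinuousLinearMap.inr ℝ ℝ E))
  have heq : D2 (1, 0) ∘L ContinuousLinearMap.inr ℝ ℝ E
      = fderiv ℝ X (ψ (s₀, z₀)) ∘L fderiv ℝ (fun z => ψ (s₀, z)) z₀ := by
    ext w
    have := hsymm (1, 0) (0, w)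
    simp only [ContinuousLinearMap.comp_apply, ContinuousLinearMap.inr_apply]
    rw [← hmixed w]
    exact this
  rw [← heq]
  refine hB.congr_of_eventuallyEq ?_ hspace₀.fderiv
  filter_upwards [htl.eventually hdiff, self_mem_nhdsWithin] with s hs hsI
  exact (hinr s z₀ hsI hz₀ hs).fderiv

theorem covector_apply {V : Type*} [AddCommGroup V] [Module ℝ V] [TopologicalSpace V]
    (α : V [⋀^Fin 1]→L[ℝ] ℝ) (v : V) : covector α v = α ![v] := by
  change α (fun _ => v) = α ![v]
  congr 1
  ext i
  fin_cases i
  rfl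

theorem extDeriv_oneForm_apply {α : E → E [⋀^Fin 1]→L[ℝ] ℝ} {x : E}
    (hα : DifferentiableAt ℝ α x) (v w : E) :
    extDeriv α x ![v, w] = fderiv ℝ (fun y => covector (α y)) x v w
      - fderiv ℝ (fun y => covector (α y)) x w v := by
  have hc : HasFDerivAt (fun y => covector (α y)) _ x :=
    (ContinuousAlternatingMap.ofSubsingletonLIE (𝕜 := ℝ) (E := E) (F := ℝ)
      (0 : Fin 1)).symm.toContinuousLinearEquiv.hasFDerivAt.comp x hα.hasFDerivAt
  have key : ∀ u r : E, fderiv ℝ (fun y => covector (α y)) x u r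
      = fderiv ℝ (fun y => α y ![r]) x u := by
    intro u r
    have h1 := hc.differentiableAt.hasFDerivAt.clm_apply (hasFDerivAt_const r x)
    have h2 : (fun y => covector (α y) r) = fun y => α y ![r] := by
      ext y
      rw [← covector_apply]
    rw [← h2, h1.fderiv]
    simp
  rw [extDeriv_apply hα, Fin.sum_univ_two, key, key]
  have e0 : (0 : Fin 2).removeNth ![v, w] = ![w] := by ext i; fin_cases i; rfl
  have e1 : (1 : Fin 2).removeNth ![v, w] = ![v] := by ext i; fin_cases i; rfl
  rw [e0, e1]
  simp [sub_eq_add_neg]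


/-- Let `P` be a skew bivector with derivative `DP` satisfying the Jacobi identity at a point, `α` a
one-form with derivative `Dα`, and `A` the derivative of the vector field `P α`. If `Pt = P ∘ dα ∘ P`
then the Lie derivative of `P` along `P α` is `-Pt`. -/
theorem lieDeriv_add_eq_zero {P Pt : (E →L[ℝ] ℝ) →L[ℝ] E} {DP : E →L[ℝ] (E →L[ℝ] ℝ) →L[ℝ] E}
    {α : E →L[ℝ] ℝ} {Dα : E →L[ℝ] E →L[ℝ] ℝ} {A : E →L[ℝ] E}
    (hP : ∀ μ ν : E →L[ℝ] ℝ, ν (P μ) = -μ (P ν))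
    (hDP : ∀ v (μ ν : E →L[ℝ] ℝ), ν (DP v μ) = -μ (DP v ν))
    (hJac : ∀ l μ ν : E →L[ℝ] ℝ,
      ν (DP (P l) μ) + l (DP (P μ) ν) + μ (DP (P ν) l) = 0)
    (hPt : ∀ μ ν : E →L[ℝ] ℝ, ν (Pt μ) = -(Dα (P μ) (P ν) - Dα (P ν) (P μ)))
    (hA : ∀ v, A v = DP v α + P (Dα v)) (μ ν : E →L[ℝ] ℝ) :
    ν ((DP (P α) + Pt) μ) = ν (A (P μ)) + ν (P (μ ∘L A)) := by
  have h1 := hP (μ ∘L A) ν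
  have h2 := hJac α μ ν
  have h3 := hDP (P μ) α ν
  have h4 := hP (Dα (P μ)) ν
  have h5 := hP (Dα (P ν)) μ
  have h6 := hPt μ ν
  simp only [ContinuousLinearMap.comp_apply, add_apply, hA, map_add] at *
  -- By skewness of `P`, the `Dα` terms on the right add up to `Pt`. What remains involves only `DP`
  -- and is the Jacobi identity on `α, μ, ν`.
  linarith

variable [FiniteDimensional ℝ E]

/-- A curve of covectors whose values on vectors are differentiable is differentiable. -/
theorem hasDerivWithinAt_covector {I : Set ℝ} {s₀ : ℝ} {w : ℝ → E →L[ℝ] ℝ} {w' : E →L[ℝ] ℝ}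
    (h : ∀ v, HasDerivWithinAt (fun s => w s v) (w' v) I s₀) : HasDerivWithinAt w w' I s₀ := by
  let b := Module.finBasis ℝ E
  let c := fun i => (LinearMap.toContinuousLinearMap (b.coord i) : E →L[ℝ] ℝ)
  have key : ∀ L : E →L[ℝ] ℝ, L = ∑ i, L (b i) • c i := by
    intro L
    ext v
    conv_lhs => rw [← b.sum_repr v]
    simp only [map_sum, map_smul]
    simp [c, mul_comm]
  rw [key w', show w = fun s => ∑ i, w s (b i) • c i from funext fun s => key (w s)]
  exact HasDerivWithinAt.fun_sum fun i _ => (h (b i)).smul_const (c i)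

/-- The derivative of a family of gauge transforms `π_s` of a fixed bivector `π₀` by 2-forms `Ω_s`
is `-π_s♯ ∘ (dΩ_s/ds) ∘ π_s♯`. -/
theorem deriv_gauge_family {I : Set ℝ} {s₀ : ℝ} (hI : UniqueDiffOn ℝ I) (hs₀ : s₀ ∈ I)
    {π₀ : Bivector E} {π : ℝ → Bivector E} {Ω : ℝ → E [⋀^Fin 2]→L[ℝ] ℝ}
    {Ω' : E [⋀^Fin 2]→L[ℝ] ℝ} {π' : (E →L[ℝ] ℝ) →L[ℝ] E}
    (hgauge : ∀ s ∈ I, gaugeMap (Ω s) '' π₀.graph = (π s).graph)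
    (hΩ : ∀ v, HasDerivWithinAt (fun s => Ω s v) (Ω' v) I s₀)
    (hπ : HasDerivWithinAt (fun s => (π s).sharp) π' I s₀) (μ : E →L[ℝ] ℝ) :
    π' μ = -(π s₀).sharp (contract Ω' ((π s₀).sharp μ)) := by
  -- For fixed `ν`, the moving covector `ν + ι Ω_s` is sent by `π_s♯` to a vector independent of
  -- `s`. The product rule applied to this constant gives the formula, with no need to invert `1 +
  -- Ω_s ∘ π₀♯`.
  have h1 : ∀ s ∈ I, ∀ ν, (π s).sharp (ν + contract (Ω s) (π₀.sharp ν)) = π₀.sharp ν := by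
    intro s hs ν
    have : gaugeMap (Ω s) (π₀.sharp ν, ν) ∈ (π s).graph := by
      rw [← hgauge s hs]; exact mem_image_of_mem _ ⟨ν, rfl⟩
    obtain ⟨κ, hκ⟩ := this
    simp only [gaugeMap, Prod.mk.injEq] at hκ
    rw [← hκ.2, hκ.1]
  -- The other inclusion of graphs: `ν` can be chosen so that the moving covector passes through the
  -- given `μ` at time `s₀`.
  have h2 : ∃ ν, π₀.sharp ν = (π s₀).sharp μ ∧ ν + contract (Ω s₀) (π₀.sharp ν) = μ := by
    have : ((π s₀).sharp μ, μ) ∈ gaugeMap (Ω s₀) '' π₀.graph := by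
      rw [hgauge s₀ hs₀]; exact ⟨μ, rfl⟩
    obtain ⟨_, ⟨ν, rfl⟩, hν⟩ := this
    simp only [gaugeMap, Prod.mk.injEq] at hν
    exact ⟨ν, hν⟩
  obtain ⟨ν, hν1, hν2⟩ := h2
  have hw : HasDerivWithinAt (fun s => ν + contract (Ω s) (π₀.sharp ν))
      (contract Ω' (π₀.sharp ν)) I s₀ := by
    refine HasDerivWithinAt.const_add ν (hasDerivWithinAt_covector fun v => ?_)
    simp only [contract_apply]
    exact hΩ _
  have h3 := hπ.clm_apply hw
  have h4 : HasDerivWithinAt (fun s => (π s).sharp (ν + contract (Ω s) (π₀.sharp ν))) 0 I s₀ :=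
    (hasDerivWithinAt_const s₀ I (π₀.sharp ν)).congr_of_mem (fun s hs => h1 s hs ν) hs₀
  have h5 := (hI s₀ hs₀).eq_deriv _ h3 h4
  rw [hν2, hν1] at h5
  exact eq_neg_of_add_eq_zero_left h5

/-- If `p_s` is transported infinitesimally by the linear maps `B_s`, then the transport of `p_s`
back to time zero has derivative zero. -/
theorem hasDerivWithinAt_transport_zero {I : Set ℝ} {s₀ : ℝ} (hs₀ : s₀ ∈ I)
    {B C : ℝ → E →L[ℝ] E} {A : E →L[ℝ] E} {p : ℝ → (E →L[ℝ] ℝ) →L[ℝ] E}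
    {p' : (E →L[ℝ] ℝ) →L[ℝ] E}
    (hB : HasDerivWithinAt B (A ∘L B s₀) I s₀)
    (hBC : ∀ᶠ s in 𝓝[I] s₀, B s ∘L C s = ContinuousLinearMap.id ℝ E)
    (hCB : ∀ᶠ s in 𝓝[I] s₀, C s ∘L B s = ContinuousLinearMap.id ℝ E)
    (hp : HasDerivWithinAt p p' I s₀)
    (h : ∀ μ ν : E →L[ℝ] ℝ, ν (p' μ) = ν (A (p s₀ μ)) + ν (p s₀ (μ ∘L A)))
    (μ ν : E →L[ℝ] ℝ) :
    HasDerivWithinAt (fun s => ν (C s (p s (μ ∘L C s)))) 0 I s₀ := by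
  have := FiniteDimensional.complete ℝ E
  let u : (E →L[ℝ] E)ˣ := ⟨B s₀, C s₀, hBC.self_of_nhdsWithin hs₀, hCB.self_of_nhdsWithin hs₀⟩
  have hinv : ∀ᶠ s in 𝓝[I] s₀, C s = Ring.inverse (B s) := by
    filter_upwards [hBC, hCB] with s h1 h2
    exact (Ring.inverse_unit (⟨B s, C s, h1, h2⟩ : (E →L[ℝ] E)ˣ)).symm
  -- The derivative of an inverse is `-C B' C`; with `B' = A B` and `B C = 1` this is `-C A`.
  have hC : HasDerivWithinAt C (-(C s₀ ∘L A)) I s₀ := by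
    have h1 : HasFDerivAt Ring.inverse _ (B s₀) := hasFDerivAt_ringInverse (𝕜 := ℝ) u
    have h2 := h1.comp_hasDerivWithinAt s₀ hB
    refine (h2.congr_of_eventuallyEq hinv (hinv.self_of_nhdsWithin hs₀)).congr_deriv ?_
    have h3 : B s₀ ∘L C s₀ = ContinuousLinearMap.id ℝ E := hBC.self_of_nhdsWithin hs₀
    change -(C s₀ ∘L (A ∘L B s₀) ∘L C s₀) = _
    rw [ContinuousLinearMap.comp_assoc A, h3, ContinuousLinearMap.comp_id]
  have hμ : HasDerivWithinAt (fun s => μ ∘L C s) (μ ∘L (-(C s₀ ∘L A))) I s₀ := by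
    simpa using (hasDerivWithinAt_const s₀ I μ).clm_comp hC
  have hf := (hasDerivWithinAt_const s₀ I ν).clm_apply (hC.clm_apply (hp.clm_apply hμ))
  -- The product rule gives `C (p' - A p - p A*) C*`, which vanishes by `h` applied to the covectors
  -- `μ ∘ C` and `ν ∘ C`.
  refine hf.congr_deriv ?_
  have h1 := h (μ ∘L C s₀) (ν ∘L C s₀)
  simp only [ContinuousLinearMap.comp_apply] at h1
  have h2 : μ ∘L (-(C s₀ ∘L A)) = -((μ ∘L C s₀) ∘L A) := by
    ext v; simp
  simp only [h2, map_add, map_neg, zero_apply, neg_apply,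
    ContinuousLinearMap.comp_apply, h1]
  ring

end Euclidean

/-! ### Tensors and the Jacobi identity in charts. -/

section Manifold

/-- A curve whose composition with all linear functionals is differentiable is differentiable. -/
theorem hasDerivWithinAt_of_forall_functional {E : Type*} [NormedAddCommGroup E] [NormedSpace ℝ E]
    [FiniteDimensional ℝ E] {I : Set ℝ} {s₀ : ℝ} {w : ℝ → E} {w' : E}
    (h : ∀ l : E →L[ℝ] ℝ, HasDerivWithinAt (fun s => l (w s)) (l w') I s₀) :
    HasDerivWithinAt w w' I s₀ := by
  let b := Module.finBasis ℝ E
  let c := fun i => (LinearMap.toContinuousLinearMap (b.coord i) : E →L[ℝ] ℝ)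
  have key : ∀ v : E, v = ∑ i, c i v • b i := fun v => (b.sum_repr v).symm
  rw [key w', show w = fun s => ∑ i, c i (w s) • b i from funext fun s => key (w s)]
  exact HasDerivWithinAt.fun_sum fun i _ => (h (c i)).smul_const (b i)

variable {E : Type*} [NormedAddCommGroup E] [NormedSpace ℝ E]
  {M : Type*} [TopologicalSpace M] [ChartedSpace E M]

/-- The differential of the chart around `c`. -/
def chartDeriv (c x : M) : TangentSpace 𝓘(ℝ, E) x →L[ℝ] E :=
  mfderiv 𝓘(ℝ, E) 𝓘(ℝ, E) (extChartAt 𝓘(ℝ, E) c) x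

/-- The differential of the inverse of the chart around `c`. -/
def chartDerivInv (c x : M) : E →L[ℝ] TangentSpace 𝓘(ℝ, E) x :=
  (mfderiv 𝓘(ℝ, E) 𝓘(ℝ, E) (extChartAt 𝓘(ℝ, E) c).symm (extChartAt 𝓘(ℝ, E) c x) : E →L[ℝ] E)

theorem bivector_inChart_apply (π : BivectorField E M) {c x : M}
    (hx : x ∈ (extChartAt 𝓘(ℝ, E) c).source) (μ : E →L[ℝ] ℝ) :
    BivectorField.inChart π c (extChartAt 𝓘(ℝ, E) c x) μ
      = chartDeriv c x ((π x).sharp (μ ∘L chartDeriv c x)) := by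
  -- The tangent space depends on the point, so the point is made a variable `z` before it is
  -- identified with `x`.
  have : ∀ z, z = x → ((π z).map
      (mfderiv 𝓘(ℝ, E) 𝓘(ℝ, E) (extChartAt 𝓘(ℝ, E) c) z) : Bivector E).sharp μ
      = chartDeriv c x ((π x).sharp (μ ∘L chartDeriv c x)) := by
    rintro _ rfl; rfl
  exact this _ ((extChartAt 𝓘(ℝ, E) c).left_inv hx)

theorem bivector_inChart_skew (π : BivectorField E M) (c : M) (z : E) (μ ν : E →L[ℝ] ℝ) :
    ν (BivectorField.inChart π c z μ) = -μ (BivectorField.inChart π c z ν) :=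
  Bivector.skew _ μ ν

variable [IsManifold 𝓘(ℝ, E) ∞ M]

theorem chartDeriv_comp_chartDerivInv {c x : M} (hx : x ∈ (extChartAt 𝓘(ℝ, E) c).source) :
    chartDeriv c x ∘L chartDerivInv c x = ContinuousLinearMap.id ℝ E := by
  have : IsManifold 𝓘(ℝ, E) 1 M := .of_le (n := ∞) (by simp)
  have := mfderiv_extChartAt_comp_mfderivWithin_extChartAt_symm' (I := 𝓘(ℝ, E)) hx
  rw [ModelWithCorners.range_eq_univ, mfderivWithin_univ] at this
  exact this

theorem chartDerivInv_comp_chartDeriv {c x : M} (hx : x ∈ (extChartAt 𝓘(ℝ, E) c).source) :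
    chartDerivInv c x ∘L chartDeriv c x = ContinuousLinearMap.id ℝ E := by
  have : IsManifold 𝓘(ℝ, E) 1 M := .of_le (n := ∞) (by simp)
  have := mfderivWithin_extChartAt_symm_comp_mfderiv_extChartAt' (I := 𝓘(ℝ, E)) hx
  rw [ModelWithCorners.range_eq_univ, mfderivWithin_univ] at this
  exact this

/-- The tangent space at `c` is the model space read through the preferred chart at `c`. Hence at
the centre of a chart the local expression of a tensor is the tensor itself, which is why charts are
always recentred below. -/
theorem chartDeriv_self (c : M) : chartDeriv c c = ContinuousLinearMap.id ℝ E := by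
  have : IsManifold 𝓘(ℝ, E) 1 M := .of_le (n := ∞) (by simp)
  exact mfderiv_extChartAt_self

theorem chartDerivInv_self (c : M) : chartDerivInv c c = ContinuousLinearMap.id ℝ E := by
  have h := chartDerivInv_comp_chartDeriv (mem_extChartAt_source (I := 𝓘(ℝ, E)) c)
  have h' := chartDeriv_self (E := E) c
  rw [h'] at h
  exact h

theorem oneForm_inChart_apply (a : DiffForm E M 1) {c x : M}
    (hx : x ∈ (extChartAt 𝓘(ℝ, E) c).source) (v : TangentSpace 𝓘(ℝ, E) x) :
    covector (DiffForm.inChart a c (extChartAt 𝓘(ℝ, E) c x)) (chartDeriv c x v)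
      = covector (a x) v := by
  have h1 : ∀ z, z = x → ∀ w : E, covector ((a z).compContinuousLinearMap
      (mfderiv 𝓘(ℝ, E) 𝓘(ℝ, E) (extChartAt 𝓘(ℝ, E) c).symm (extChartAt 𝓘(ℝ, E) c x) : E →L[ℝ] E)) w
      = covector (a x) (chartDerivInv c x w) := by
    rintro _ rfl w; rfl
  refine (h1 _ ((extChartAt 𝓘(ℝ, E) c).left_inv hx) _).trans ?_
  have h2 := DFunLike.congr_fun (chartDerivInv_comp_chartDeriv hx) v
  exact congrArg (covector (a x)) h2

/-- The vector field `π♯ a` in a chart. -/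
theorem sharp_inChart (π : BivectorField E M) (a : DiffForm E M 1) {c x : M}
    (hx : x ∈ (extChartAt 𝓘(ℝ, E) c).source) :
    BivectorField.inChart π c (extChartAt 𝓘(ℝ, E) c x)
        (covector (DiffForm.inChart a c (extChartAt 𝓘(ℝ, E) c x)))
      = chartDeriv c x ((π x).sharp (covector (a x))) := by
  rw [bivector_inChart_apply π hx]
  congr 2
  ext v
  exact oneForm_inChart_apply a hx v

theorem differential_of_eventuallyEq {f : M → ℝ} {k : E → ℝ} {c x : M}
    (hx : x ∈ (extChartAt 𝓘(ℝ, E) c).source)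
    (hk : DifferentiableAt ℝ k (extChartAt 𝓘(ℝ, E) c x))
    (hf : f =ᶠ[𝓝 x] fun x => k (extChartAt 𝓘(ℝ, E) c x)) (v : TangentSpace 𝓘(ℝ, E) x) :
    differential f x v = fderiv ℝ k (extChartAt 𝓘(ℝ, E) c x) (chartDeriv c x v) := by
  have : IsManifold 𝓘(ℝ, E) 1 M := .of_le (n := ∞) (by simp)
  have h1 : mfderiv 𝓘(ℝ, E) 𝓘(ℝ, ℝ) f x
      = mfderiv 𝓘(ℝ, E) 𝓘(ℝ, ℝ) (k ∘ extChartAt 𝓘(ℝ, E) c) x := hf.mfderiv_eq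
  have h2 := mfderiv_comp x (I := 𝓘(ℝ, E)) (I' := 𝓘(ℝ, E)) (I'' := 𝓘(ℝ, ℝ))
    hk.mdifferentiableAt (mdifferentiableAt_extChartAt (by rwa [extChartAt_source] at hx))
  have h3 := DFunLike.congr_fun (h1.trans h2) v
  rw [mfderiv_eq_fderiv] at h3
  exact h3

variable [FiniteDimensional ℝ E]

/-- A curve which satisfies the flow equation on smooth functions satisfies it in charts. -/
theorem hasDerivWithinAt_extChartAt_of_functions {I : Set ℝ} {s₀ : ℝ} {c : M} {U : Set M}
    (hUo : IsOpen U) (hUs : U ⊆ (extChartAt 𝓘(ℝ, E) c).source)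
    (hU : ∀ l : E →L[ℝ] ℝ, ∃ f : M → ℝ, ContMDiff 𝓘(ℝ, E) 𝓘(ℝ, ℝ) ∞ f ∧
        ∀ x ∈ U, f =ᶠ[𝓝 x] fun x => l (extChartAt 𝓘(ℝ, E) c x))
    {γ : ℝ → M} (hγ : ContinuousWithinAt γ I s₀) (hγU : γ s₀ ∈ U)
    {X : TangentSpace 𝓘(ℝ, E) (γ s₀)}
    (hX : ∀ f : M → ℝ, ContMDiff 𝓘(ℝ, E) 𝓘(ℝ, ℝ) ∞ f →
      HasDerivWithinAt (fun s => f (γ s)) (differential f (γ s₀) X) I s₀) :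
    HasDerivWithinAt (fun s => extChartAt 𝓘(ℝ, E) c (γ s)) (chartDeriv c (γ s₀) X) I s₀ := by
  refine hasDerivWithinAt_of_forall_functional fun l => ?_
  obtain ⟨f, hf, hfU⟩ := hU l
  have h1 := hX f hf
  rw [differential_of_eventuallyEq (hUs hγU) l.differentiableAt (hfU _ hγU),
    ContinuousLinearMap.fderiv] at h1
  refine h1.congr_of_eventuallyEq ?_ (hfU _ hγU).self_of_nhds.symm
  filter_upwards [hγ (hUo.mem_nhds hγU)] with s hs
  exact (hfU _ hs).self_of_nhds.symm

variable [T2Space M]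

/-- Near `c`, the components of the chart extend to global smooth functions. -/
theorem exists_smooth_extension (c : M) :
    ∃ U : Set M, IsOpen U ∧ c ∈ U ∧ U ⊆ (extChartAt 𝓘(ℝ, E) c).source ∧
      ∀ l : E →L[ℝ] ℝ, ∃ f : M → ℝ, ContMDiff 𝓘(ℝ, E) 𝓘(ℝ, ℝ) ∞ f ∧
        ∀ x ∈ U, f =ᶠ[𝓝 x] fun x => l (extChartAt 𝓘(ℝ, E) c x) := by
  obtain ⟨β⟩ : Nonempty (SmoothBumpFunction 𝓘(ℝ, E) c) := inferInstance
  obtain ⟨U, hU, hUo, hcU⟩ := eventually_nhds_iff.1 β.eventuallyEq_one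
  refine ⟨U ∩ (extChartAt 𝓘(ℝ, E) c).source, hUo.inter (isOpen_extChartAt_source c),
    ⟨hcU, mem_extChartAt_source c⟩, inter_subset_right, fun l => ?_⟩
  -- The bump function is `1` on the open set `U`, so the product has the same germ as the
  -- coordinate at every point of `U`. Global functions are needed because the Jacobi identity and
  -- the flow equation are tested only on them.
  refine ⟨fun x => β x • l (extChartAt 𝓘(ℝ, E) c x), β.contMDiff_smul ?_, fun x hx => ?_⟩
  · exact l.contMDiff.comp_contMDiffOn (contMDiffOn_extChartAt (n := ∞))
  · filter_upwards [hUo.mem_nhds hx.1] with z hz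
    have := hU z hz
    simp [this]

/-- Tested on functions that are linear in the chart: their differentials are constant there, so an
iterated bracket contains only the first derivative of `π`, as in `{f, {g, h}} = ν (DP (P l) μ)`. -/
theorem jacobi_inChart {π : BivectorField E M} (hπ : IsPoisson π) (c : M)
    (hd : DifferentiableAt ℝ (BivectorField.inChart π c) (extChartAt 𝓘(ℝ, E) c c))
    (l μ ν : E →L[ℝ] ℝ) :
    ν (fderiv ℝ (BivectorField.inChart π c) (extChartAt 𝓘(ℝ, E) c c)
        (BivectorField.inChart π c (extChartAt 𝓘(ℝ, E) c c) l) μ)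
      + l (fderiv ℝ (BivectorField.inChart π c) (extChartAt 𝓘(ℝ, E) c c)
        (BivectorField.inChart π c (extChartAt 𝓘(ℝ, E) c c) μ) ν)
      + μ (fderiv ℝ (BivectorField.inChart π c) (extChartAt 𝓘(ℝ, E) c c)
        (BivectorField.inChart π c (extChartAt 𝓘(ℝ, E) c c) ν) l) = 0 := by
  obtain ⟨U, hUo, hcU, hUs, hU⟩ := exists_smooth_extension (E := E) c
  have hlin : ∀ {f : M → ℝ} {l : E →L[ℝ] ℝ},
      (∀ x ∈ U, f =ᶠ[𝓝 x] fun x => l (extChartAt 𝓘(ℝ, E) c x)) → ∀ x ∈ U,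
      differential f x = l ∘L chartDeriv c x := by
    intro f l hf x hx
    ext v
    rw [differential_of_eventuallyEq (hUs hx) l.differentiableAt (hf x hx)]
    simp
  have hbr : ∀ {f g : M → ℝ} {l μ : E →L[ℝ] ℝ},
      (∀ x ∈ U, f =ᶠ[𝓝 x] fun x => l (extChartAt 𝓘(ℝ, E) c x)) →
      (∀ x ∈ U, g =ᶠ[𝓝 x] fun x => μ (extChartAt 𝓘(ℝ, E) c x)) → ∀ x ∈ U,
      bracket π f g x = μ (BivectorField.inChart π c (extChartAt 𝓘(ℝ, E) c x) l) := by
    intro f g l μ hf hg x hx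
    rw [bivector_inChart_apply π (hUs hx)]
    simp only [bracket, Bivector.pair, hlin hf x hx, hlin hg x hx]
    rfl
  have hbrbr : ∀ {f g h : M → ℝ} {l μ ν : E →L[ℝ] ℝ},
      (∀ x ∈ U, f =ᶠ[𝓝 x] fun x => l (extChartAt 𝓘(ℝ, E) c x)) →
      (∀ x ∈ U, g =ᶠ[𝓝 x] fun x => μ (extChartAt 𝓘(ℝ, E) c x)) →
      (∀ x ∈ U, h =ᶠ[𝓝 x] fun x => ν (extChartAt 𝓘(ℝ, E) c x)) →
      bracket π f (bracket π g h) c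
        = ν (fderiv ℝ (BivectorField.inChart π c) (extChartAt 𝓘(ℝ, E) c c)
          (BivectorField.inChart π c (extChartAt 𝓘(ℝ, E) c c) l) μ) := by
    intro f g h l μ ν hf hg hh
    have hk : HasFDerivAt (fun z => ν (BivectorField.inChart π c z μ)) _
        (extChartAt 𝓘(ℝ, E) c c) :=
      ν.hasFDerivAt.comp _ (hd.hasFDerivAt.clm_apply (hasFDerivAt_const μ _))
    have h1 : bracket π g h =ᶠ[𝓝 c]
        fun x => ν (BivectorField.inChart π c (extChartAt 𝓘(ℝ, E) c x) μ) := by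
      filter_upwards [hUo.mem_nhds hcU] with x hx
      exact hbr hg hh x hx
    rw [bracket, Bivector.pair, hlin hf c hcU,
      differential_of_eventuallyEq (k := fun z => ν (BivectorField.inChart π c z μ))
        (mem_extChartAt_source c) hk.differentiableAt h1, hk.fderiv,
      bivector_inChart_apply π (mem_extChartAt_source c)]
    simp
  obtain ⟨f, hf, hf'⟩ := hU l
  obtain ⟨g, hg, hg'⟩ := hU μ
  obtain ⟨h, hh, hh'⟩ := hU ν
  have := hπ f g h hf hg hh c
  rwa [hbrbr hf' hg' hh', hbrbr hg' hh' hf', hbrbr hh' hf' hg'] at this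

end Manifold

/-! ### Moser's cancellation in a chart. -/

section Moser

variable {E : Type*} [NormedAddCommGroup E] [NormedSpace ℝ E]
  {M : Type*} [TopologicalSpace M] [ChartedSpace E M]

/-- The vector field `π♯ a` in the chart around `c`. -/
def sharpFieldInChart (π : BivectorField E M) (a : DiffForm E M 1) (c : M) (z : E) : E :=
  BivectorField.inChart π c z (covector (DiffForm.inChart a c z))

theorem differentiableAt_covector {α : E → E [⋀^Fin 1]→L[ℝ] ℝ} {x : E}
    (hα : DifferentiableAt ℝ α x) : DifferentiableAt ℝ (fun y => covector (α y)) x :=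
  (ContinuousAlternatingMap.ofSubsingletonLIE (𝕜 := ℝ) (E := E) (F := ℝ)
      (0 : Fin 1)).symm.toContinuousLinearEquiv.differentiableAt.comp x hα

theorem differentiableAt_slice {F : Type*} [NormedAddCommGroup F] [NormedSpace ℝ F]
    {J : Set ℝ} {c : M} {G : ℝ × E → F}
    (hG : ContDiffOn ℝ ∞ G (J ×ˢ (extChartAt 𝓘(ℝ, E) c).target)) {s : ℝ} (hs : s ∈ J) :
    DifferentiableAt ℝ (fun z => G (s, z)) (extChartAt 𝓘(ℝ, E) c c) := by
  have h1 := (hG.differentiableOn (by simp)) (s, extChartAt 𝓘(ℝ, E) c c)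
    ⟨hs, mem_extChartAt_target c⟩
  have h2 : HasFDerivWithinAt (fun z : E => (s, z)) (ContinuousLinearMap.inr ℝ ℝ E)
      (extChartAt 𝓘(ℝ, E) c).target (extChartAt 𝓘(ℝ, E) c c) :=
    (hasFDerivAt_prodMk_right s _).hasFDerivWithinAt
  exact ((h1.hasFDerivWithinAt.comp _ h2
    (fun z hz => ⟨hs, hz⟩)).hasFDerivAt (extChartAt_target_mem_nhds c)).differentiableAt

theorem differentiableAt_sharpFieldInChart {J : Set ℝ} {π : ℝ → BivectorField E M}
    {a : ℝ → DiffForm E M 1} (hπ : SmoothBivectorFamily J π) (ha : SmoothFormFamily J a)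
    {s : ℝ} (hs : s ∈ J) (c : M) :
    DifferentiableAt ℝ (sharpFieldInChart (π s) (a s) c) (extChartAt 𝓘(ℝ, E) c c) :=
  (differentiableAt_slice (hπ c) hs).clm_apply
    (differentiableAt_covector (differentiableAt_slice (ha c) hs))

/-- The chain rule with the explicit time derivative `Gt` kept apart from the space derivative: the
gauge relation determines `Gt`, the Jacobi identity controls the other term. -/
theorem exists_hasDerivWithinAt_along_curve {F : Type*} [NormedAddCommGroup F] [NormedSpace ℝ F]
    {I : Set ℝ} {T : Set E} {s₀ : ℝ} {x₀ : E} (hs₀ : s₀ ∈ I) (hT : T ∈ 𝓝 x₀) {G : ℝ × E → F}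
    (hG : DifferentiableWithinAt ℝ G (I ×ˢ T) (s₀, x₀)) :
    ∃ Gt : F, HasDerivWithinAt (fun s => G (s, x₀)) Gt I s₀ ∧
      ∀ (γ : ℝ → E) (X : E), γ s₀ = x₀ → HasDerivWithinAt γ X I s₀ →
        (∀ᶠ s in 𝓝[I] s₀, γ s ∈ T) →
        HasDerivWithinAt (fun s => G (s, γ s)) (fderiv ℝ (fun z => G (s₀, z)) x₀ X + Gt) I s₀ := by
  obtain ⟨L, hL⟩ := hG
  have hx₀T : x₀ ∈ T := mem_of_mem_nhds hT
  have hspace : fderiv ℝ (fun z => G (s₀, z)) x₀ = L ∘L ContinuousLinearMap.inr ℝ ℝ E := by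
    have h2 : HasFDerivWithinAt (fun z : E => (s₀, z)) (ContinuousLinearMap.inr ℝ ℝ E) T x₀ :=
      (hasFDerivAt_prodMk_right s₀ _).hasFDerivWithinAt
    exact ((hL.comp x₀ h2
      (show MapsTo _ T (I ×ˢ T) from fun z hz => ⟨hs₀, hz⟩)).hasFDerivAt hT).fderiv
  refine ⟨L (1, 0), ?_, fun γ X hγ₀ hγ hγt => ?_⟩
  · have h2 : HasDerivWithinAt (fun s : ℝ => (s, x₀)) ((1 : ℝ), (0 : E)) I s₀ :=
      (hasDerivWithinAt_id s₀ I).prodMk (hasDerivWithinAt_const s₀ I x₀)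
    exact hL.comp_hasDerivWithinAt s₀ h2
      (show MapsTo _ I (I ×ˢ T) from fun s hs => ⟨hs, hx₀T⟩)
  · have h2 : HasDerivWithinAt (fun s : ℝ => (s, γ s)) ((1 : ℝ), X) (I ∩ γ ⁻¹' T) s₀ :=
      ((hasDerivWithinAt_id s₀ I).prodMk hγ).mono inter_subset_left
    have h3 := HasFDerivWithinAt.comp_hasDerivWithinAt_of_eq s₀ hL h2
      (show MapsTo _ (I ∩ γ ⁻¹' T) (I ×ˢ T) from fun s hs => ⟨hs.1, hs.2⟩) (by rw [hγ₀])
    refine (h3.mono_of_mem_nhdsWithin (inter_mem self_mem_nhdsWithin hγt)).congr_deriv ?_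
    rw [hspace, ContinuousLinearMap.comp_apply, ContinuousLinearMap.inr_apply, ← map_add]
    simp

variable [IsManifold 𝓘(ℝ, E) ∞ M] [FiniteDimensional ℝ E]

/-- At the centre `c` the chart changes nothing, so `deriv_gauge_family` applies in the fixed
tangent space at `c`. With `dΩ/ds = -da` it gives `Pt = P ∘ da ∘ P`; skewness of `P` turns this into
`-da(P μ, P ν)`. -/
theorem deriv_bivector_inChart_of_gauge {J I : Set ℝ} (hIJ : I ⊆ J) (hI : UniqueDiffOn ℝ I)
    {π : ℝ → BivectorField E M} {Ω : ℝ → DiffForm E M 2} {a : ℝ → DiffForm E M 1}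
    (ha : SmoothFormFamily J a)
    (h_gauge : ∀ t ∈ J, IsGaugeTransform (π 0) (Ω t) (π t))
    (hΩ_deriv : ∀ t ∈ J, ∀ (x : M) (v : Fin 2 → TangentSpace 𝓘(ℝ, E) x),
      HasDerivWithinAt (fun s => Ω s x v) (-(DiffForm.d (a t) x v)) J t)
    {s₀ : ℝ} (hs₀ : s₀ ∈ I) (c : M) {Pt : (E →L[ℝ] ℝ) →L[ℝ] E}
    (hPt : HasDerivWithinAt
      (fun s => BivectorField.inChart (π s) c (extChartAt 𝓘(ℝ, E) c c)) Pt I s₀)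
    (μ ν : E →L[ℝ] ℝ) :
    ν (Pt μ) = -(fderiv ℝ (fun z => covector (DiffForm.inChart (a s₀) c z))
          (extChartAt 𝓘(ℝ, E) c c)
          (BivectorField.inChart (π s₀) c (extChartAt 𝓘(ℝ, E) c c) μ)
          (BivectorField.inChart (π s₀) c (extChartAt 𝓘(ℝ, E) c c) ν)
        - fderiv ℝ (fun z => covector (DiffForm.inChart (a s₀) c z))
          (extChartAt 𝓘(ℝ, E) c c)
          (BivectorField.inChart (π s₀) c (extChartAt 𝓘(ℝ, E) c c) ν)
          (BivectorField.inChart (π s₀) c (extChartAt 𝓘(ℝ, E) c c) μ)) := by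
  let q : ℝ → Bivector E := fun s => (π s c : Bivector E)
  have hq : ∀ s, BivectorField.inChart (π s) c (extChartAt 𝓘(ℝ, E) c c) = (q s).sharp := by
    intro s
    ext1 μ
    have h := bivector_inChart_apply (π s) (mem_extChartAt_source (I := 𝓘(ℝ, E)) c) μ
    have h' := chartDeriv_self (E := E) c
    rw [h'] at h
    exact h
  simp only [hq] at hPt ⊢
  let o : ℝ → E [⋀^Fin 2]→L[ℝ] ℝ := fun s => (Ω s c : E [⋀^Fin 2]→L[ℝ] ℝ)
  let o' : E [⋀^Fin 2]→L[ℝ] ℝ :=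
    -(extDeriv (DiffForm.inChart (a s₀) c) (extChartAt 𝓘(ℝ, E) c c))
  have hd : ∀ v : Fin 2 → E, DiffForm.d (a s₀) c v
      = extDeriv (DiffForm.inChart (a s₀) c) (extChartAt 𝓘(ℝ, E) c c) v := by
    intro v
    have h' := chartDeriv_self (E := E) c
    change extDeriv (DiffForm.inChart (a s₀) c) (extChartAt 𝓘(ℝ, E) c c)
      (fun i => chartDeriv c c (v i)) = _
    rw [h']
    rfl
  have h1 := deriv_gauge_family hI hs₀ (π₀ := q 0) (π := q) (Ω := o) (Ω' := o')
    (fun s hs => h_gauge s (hIJ hs) c)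
    (fun v => by
      have := (hΩ_deriv s₀ (hIJ hs₀) c v).mono hIJ
      rw [hd v] at this
      exact this) hPt μ
  rw [h1, map_neg, (q s₀).skew, contract_apply]
  have h2 := extDeriv_oneForm_apply (differentiableAt_slice (ha c) (hIJ hs₀))
    ((q s₀).sharp μ) ((q s₀).sharp ν)
  simp only [o', ContinuousAlternatingMap.neg_apply]
  rw [← h2]
  simp

variable [T2Space M]

/-- Along a curve tangent to `X = π_s♯ a_s` at time `s₀`, the bivectors `π_s` are transported
infinitesimally by `X`. -/
theorem exists_hasDerivWithinAt_bivector_inChart {J I : Set ℝ} (hIJ : I ⊆ J)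
    (hI : UniqueDiffOn ℝ I)
    {π : ℝ → BivectorField E M} {Ω : ℝ → DiffForm E M 2} {a : ℝ → DiffForm E M 1}
    (hπ : SmoothBivectorFamily J π) (ha : SmoothFormFamily J a)
    (hπ_poisson : ∀ t ∈ J, IsPoisson (π t))
    (h_gauge : ∀ t ∈ J, IsGaugeTransform (π 0) (Ω t) (π t))
    (hΩ_deriv : ∀ t ∈ J, ∀ (x : M) (v : Fin 2 → TangentSpace 𝓘(ℝ, E) x),
      HasDerivWithinAt (fun s => Ω s x v) (-(DiffForm.d (a t) x v)) J t)
    {s₀ : ℝ} (hs₀ : s₀ ∈ I) (c : M) {γ : ℝ → E}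
    (hγ₀ : γ s₀ = extChartAt 𝓘(ℝ, E) c c)
    (hγ : HasDerivWithinAt γ (sharpFieldInChart (π s₀) (a s₀) c (extChartAt 𝓘(ℝ, E) c c)) I s₀)
    (hγt : ∀ᶠ s in 𝓝[I] s₀, γ s ∈ (extChartAt 𝓘(ℝ, E) c).target) :
    ∃ p' : (E →L[ℝ] ℝ) →L[ℝ] E,
      HasDerivWithinAt (fun s => BivectorField.inChart (π s) c (γ s)) p' I s₀ ∧
      ∀ μ ν : E →L[ℝ] ℝ, ν (p' μ)
        = ν (fderiv ℝ (sharpFieldInChart (π s₀) (a s₀) c) (extChartAt 𝓘(ℝ, E) c c)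
            (BivectorField.inChart (π s₀) c (γ s₀) μ))
          + ν (BivectorField.inChart (π s₀) c (γ s₀)
            (μ ∘L fderiv ℝ (sharpFieldInChart (π s₀) (a s₀) c) (extChartAt 𝓘(ℝ, E) c c))) := by
  set x₀ := extChartAt 𝓘(ℝ, E) c c with hx₀
  set T := (extChartAt 𝓘(ℝ, E) c).target with hT
  have hTx : T ∈ 𝓝 x₀ := extChartAt_target_mem_nhds c
  have hx₀T : x₀ ∈ T := mem_of_mem_nhds hTx
  have hs₀J := hIJ hs₀
  have hGd : DifferentiableWithinAt ℝ
      (fun p : ℝ × E => BivectorField.inChart (π p.1) c p.2) (I ×ˢ T) (s₀, x₀) :=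
    (((hπ c).differentiableOn (by simp)) (s₀, x₀) ⟨hs₀J, hx₀T⟩).mono (prod_mono hIJ Subset.rfl)
  obtain ⟨Pt, hPt, hcurve⟩ := exists_hasDerivWithinAt_along_curve
    (F := (E →L[ℝ] ℝ) →L[ℝ] E) hs₀ hTx hGd
  have hPd : DifferentiableAt ℝ (BivectorField.inChart (π s₀) c) x₀ :=
    differentiableAt_slice (hπ c) hs₀J
  set X₀ := sharpFieldInChart (π s₀) (a s₀) c x₀ with hX₀
  have hαd : DifferentiableAt ℝ (fun z => covector (DiffForm.inChart (a s₀) c z)) x₀ :=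
    differentiableAt_covector (differentiableAt_slice (ha c) hs₀J)
  refine ⟨_, hcurve γ X₀ hγ₀ hγ hγt, fun μ ν => ?_⟩
  · rw [hγ₀]
    refine lieDeriv_add_eq_zero (Dα := fderiv ℝ
      (fun z => covector (DiffForm.inChart (a s₀) c z)) x₀)
      (bivector_inChart_skew (π s₀) c x₀) (fun v μ ν => ?_)
      (jacobi_inChart (hπ_poisson s₀ hs₀J) c hPd)
      (deriv_bivector_inChart_of_gauge hIJ hI ha h_gauge hΩ_deriv hs₀ c hPt)
      (fun v => ?_) μ ν
    · have e : ∀ μ ν : E →L[ℝ] ℝ,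
          HasFDerivAt (fun z => ν (BivectorField.inChart (π s₀) c z μ)) _ x₀ := fun μ ν =>
        ν.hasFDerivAt.comp x₀ (hPd.hasFDerivAt.clm_apply (hasFDerivAt_const μ x₀))
      have e1 := (e ν μ).neg
      have e2 := (e μ ν).unique (e1.congr_of_eventuallyEq (Eventually.of_forall fun z =>
        bivector_inChart_skew (π s₀) c z μ ν))
      simpa [hx₀] using DFunLike.congr_fun e2 v
    -- Product rule for `X = P α`: the derivative of `X` is `v ↦ DP(v) α + P (Dα v)`.
    · have e : HasFDerivAt (sharpFieldInChart (π s₀) (a s₀) c) _ x₀ :=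
        hPd.hasFDerivAt.clm_apply hαd.hasFDerivAt
      rw [e.fderiv]
      simp [add_comm, hx₀]

end Moser

/-! ### The flow and its differential in charts. -/

section Flow

variable {E : Type*} [NormedAddCommGroup E] [NormedSpace ℝ E]
  {M : Type*} [TopologicalSpace M] [ChartedSpace E M]

/-- The value of `Φ_* π`, evaluated on two covectors, at the image of `x`. -/
def pushPair (Φ : OpenPartialHomeomorph M M) (π : BivectorField E M) (x : M)
    (μ ν : E →L[ℝ] ℝ) : ℝ :=
  ((π x).map (W := E) (mfderiv 𝓘(ℝ, E) 𝓘(ℝ, E) Φ x : E →L[ℝ] E)).pair μ ν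

/-- The flow, read in the charts around `c` (in the target) and around `y` (in the source). -/
def flowInChart (Φ : ℝ → OpenPartialHomeomorph M M) (c y : M) (p : ℝ × E) : E :=
  extChartAt 𝓘(ℝ, E) c ((Φ p.1).symm ((extChartAt 𝓘(ℝ, E) y).symm p.2))

theorem flowInChart_self (Φ : ℝ → OpenPartialHomeomorph M M) (c y : M) (s : ℝ) :
    flowInChart Φ c y (s, extChartAt 𝓘(ℝ, E) y y) = extChartAt 𝓘(ℝ, E) c ((Φ s).symm y) := by
  rw [flowInChart, extChartAt_to_inv]

theorem hasMFDerivAt_comp_of_eq {M₁ M₂ M₃ : Type*} [TopologicalSpace M₁] [ChartedSpace E M₁]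
    [TopologicalSpace M₂] [ChartedSpace E M₂] [TopologicalSpace M₃] [ChartedSpace E M₃]
    {g : M₂ → M₃} {f : M₁ → M₂} {x : M₁} {y : M₂} {g' f' : E →L[ℝ] E}
    (hg : HasMFDerivAt 𝓘(ℝ, E) 𝓘(ℝ, E) g y g') (hf : HasMFDerivAt 𝓘(ℝ, E) 𝓘(ℝ, E) f x f')
    (h : f x = y) : HasMFDerivAt 𝓘(ℝ, E) 𝓘(ℝ, E) (g ∘ f) x (g' ∘L f') := by
  subst h
  exact hg.comp x hf

variable {J I : Set ℝ} {X : ℝ → VecField E M}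
  {Φ : ℝ → OpenPartialHomeomorph M M} {V : Set M}

theorem IsLocalFlow.mdifferentiableAt (hΦ : IsLocalFlow J X Φ) {s : ℝ} (hs : s ∈ J) {x : M}
    (hx : x ∈ (Φ s).source) : MDifferentiableAt 𝓘(ℝ, E) 𝓘(ℝ, E) (Φ s) x :=
  ((hΦ.smooth s hs x hx).contMDiffAt ((Φ s).open_source.mem_nhds hx)).mdifferentiableAt (by simp)

theorem IsLocalFlow.mdifferentiableAt_symm (hΦ : IsLocalFlow J X Φ) {s : ℝ} (hs : s ∈ J) {y : M}
    (hy : y ∈ (Φ s).target) : MDifferentiableAt 𝓘(ℝ, E) 𝓘(ℝ, E) (Φ s).symm y := by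
  have h1 : ContMDiffWithinAt 𝓘(ℝ, E) (𝓘(ℝ, ℝ).prod 𝓘(ℝ, E)) ∞
      (fun z : M => ((s, z) : ℝ × M)) (Φ s).target y :=
    (contMDiff_const.prodMk contMDiff_id).contMDiffAt.contMDiffWithinAt
  have h2 := ContMDiffWithinAt.comp y (g := fun p : ℝ × M => (Φ p.1).symm p.2)
    (hΦ.smooth_symm (s, y) ⟨hs, hy⟩) h1 (fun z hz => ⟨hs, hz⟩)
  exact (h2.contMDiffAt ((Φ s).open_target.mem_nhds hy)).mdifferentiableAt (by simp)

variable [IsManifold 𝓘(ℝ, E) ∞ M]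

theorem IsLocalFlow.contDiffWithinAt_flowInChart (hΦ : IsLocalFlow J X Φ) (hIJ : I ⊆ J)
    (hV : ∀ s ∈ I, V ⊆ (Φ s).target) {s₀ : ℝ} (hs₀ : s₀ ∈ I) {y c : M} (hy : y ∈ V)
    (hc : (Φ s₀).symm y ∈ (extChartAt 𝓘(ℝ, E) c).source) :
    ContDiffWithinAt ℝ 2 (flowInChart Φ c y)
      (I ×ˢ ((extChartAt 𝓘(ℝ, E) y).target ∩ (extChartAt 𝓘(ℝ, E) y).symm ⁻¹' V))
      (s₀, extChartAt 𝓘(ℝ, E) y y) := by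
  set S := I ×ˢ ((extChartAt 𝓘(ℝ, E) y).target ∩ (extChartAt 𝓘(ℝ, E) y).symm ⁻¹' V)
  have h0 : (extChartAt 𝓘(ℝ, E) y).symm (extChartAt 𝓘(ℝ, E) y y) = y := extChartAt_to_inv y
  have h1 : ContMDiffWithinAt 𝓘(ℝ, ℝ × E) (𝓘(ℝ, ℝ).prod 𝓘(ℝ, E)) ∞
      (fun p : ℝ × E => ((p.1, (extChartAt 𝓘(ℝ, E) y).symm p.2) : ℝ × M)) S
      (s₀, extChartAt 𝓘(ℝ, E) y y) := by
    refine ContMDiffWithinAt.prodMk contDiff_fst.contMDiff.contMDiffAt.contMDiffWithinAt ?_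
    have := (contMDiffOn_extChartAt_symm (I := 𝓘(ℝ, E)) (n := ∞) y)
      (extChartAt 𝓘(ℝ, E) y y) (mem_extChartAt_target y)
    exact this.comp (s₀, extChartAt 𝓘(ℝ, E) y y)
      contDiff_snd.contMDiff.contMDiffAt.contMDiffWithinAt (fun p hp => hp.2.1)
  have h2 : ContMDiffWithinAt 𝓘(ℝ, ℝ × E) 𝓘(ℝ, E) ∞
      (fun p : ℝ × E => (Φ p.1).symm ((extChartAt 𝓘(ℝ, E) y).symm p.2)) S
      (s₀, extChartAt 𝓘(ℝ, E) y y) := by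
    refine ContMDiffWithinAt.comp_of_eq (g := fun p : ℝ × M => (Φ p.1).symm p.2)
      (hΦ.smooth_symm (s₀, y) ⟨hIJ hs₀, hV s₀ hs₀ hy⟩) h1
      (fun p hp => ⟨hIJ hp.1, hV _ hp.1 hp.2.2⟩) ?_
    rw [h0]
  have h3 : ContMDiffWithinAt 𝓘(ℝ, ℝ × E) 𝓘(ℝ, E) ∞ (flowInChart Φ c y) S
      (s₀, extChartAt 𝓘(ℝ, E) y y) := by
    refine ContMDiffAt.comp_contMDiffWithinAt_of_eq
      (g := extChartAt 𝓘(ℝ, E) c) (contMDiffAt_extChartAt' (n := ∞) ?_) h2 rfl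
    rw [h0]
    rwa [extChartAt_source] at hc
  exact (contMDiffWithinAt_iff_contDiffWithinAt.1 h3).of_le ENat.LEInfty.out

/-- The differential of `Φ_s` after the inverse chart. It inverts the differential of
`flowInChart`. -/
def flowDerivInv (Φ : ℝ → OpenPartialHomeomorph M M) (c y : M) (s : ℝ) : E →L[ℝ] E :=
  (mfderiv 𝓘(ℝ, E) 𝓘(ℝ, E) (Φ s) ((Φ s).symm y) : E →L[ℝ] E) ∘L
    (chartDerivInv c ((Φ s).symm y) : E →L[ℝ] E)

/-- The inverse chart around `y` contributes no factor, its differential at the centre being the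
identity. -/
theorem IsLocalFlow.fderiv_flowInChart (hΦ : IsLocalFlow J X Φ) {s : ℝ} (hs : s ∈ J) {y c : M}
    (hy : y ∈ (Φ s).target) (hc : (Φ s).symm y ∈ (extChartAt 𝓘(ℝ, E) c).source) :
    fderiv ℝ (fun z => flowInChart Φ c y (s, z)) (extChartAt 𝓘(ℝ, E) y y)
      = (chartDeriv c ((Φ s).symm y) : E →L[ℝ] E) ∘L
        (mfderiv 𝓘(ℝ, E) 𝓘(ℝ, E) (Φ s).symm y : E →L[ℝ] E) := by
  have : IsManifold 𝓘(ℝ, E) 1 M := .of_le (n := ∞) (by simp)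
  have h0 : (extChartAt 𝓘(ℝ, E) y).symm (extChartAt 𝓘(ℝ, E) y y) = y := extChartAt_to_inv y
  have hinv : HasMFDerivAt 𝓘(ℝ, E) 𝓘(ℝ, E) (extChartAt 𝓘(ℝ, E) y).symm
      (extChartAt 𝓘(ℝ, E) y y) (ContinuousLinearMap.id ℝ E) := by
    have h1 : MDifferentiableAt 𝓘(ℝ, E) 𝓘(ℝ, E) (extChartAt 𝓘(ℝ, E) y).symm
        (extChartAt 𝓘(ℝ, E) y y) := by
      have := mdifferentiableWithinAt_extChartAt_symm (I := 𝓘(ℝ, E)) (mem_extChartAt_target y)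
      rwa [ModelWithCorners.range_eq_univ, mdifferentiableWithinAt_univ] at this
    have h2 := h1.hasMFDerivAt
    have h3 := chartDerivInv_self (E := E) y
    exact h3 ▸ h2
  have hsymm := (hΦ.mdifferentiableAt_symm hs hy).hasMFDerivAt
  have hchart := (mdifferentiableAt_extChartAt (I := 𝓘(ℝ, E))
    (by rwa [extChartAt_source] at hc : (Φ s).symm y ∈ (chartAt E c).source)).hasMFDerivAt
  have h1 : HasMFDerivAt 𝓘(ℝ, E) 𝓘(ℝ, E) (extChartAt 𝓘(ℝ, E) c ∘ (Φ s).symm) y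
      ((chartDeriv c ((Φ s).symm y) : E →L[ℝ] E) ∘L
        (mfderiv 𝓘(ℝ, E) 𝓘(ℝ, E) (Φ s).symm y : E →L[ℝ] E)) := hchart.comp y hsymm
  have h2 := hasMFDerivAt_comp_of_eq h1 hinv h0
  let B : E →L[ℝ] E := (chartDeriv c ((Φ s).symm y) : E →L[ℝ] E) ∘L
    (mfderiv 𝓘(ℝ, E) 𝓘(ℝ, E) (Φ s).symm y : E →L[ℝ] E)
  have h3 : HasFDerivAt (fun z => flowInChart Φ c y (s, z)) B (extChartAt 𝓘(ℝ, E) y y) :=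
    hasMFDerivAt_iff_hasFDerivAt.1 h2
  exact h3.fderiv

theorem IsLocalFlow.flowDerivInv_comp (hΦ : IsLocalFlow J X Φ) {s : ℝ} (hs : s ∈ J) {y c : M}
    (hy : y ∈ (Φ s).target) (hc : (Φ s).symm y ∈ (extChartAt 𝓘(ℝ, E) c).source) :
    flowDerivInv Φ c y s ∘L
      fderiv ℝ (fun z => flowInChart Φ c y (s, z)) (extChartAt 𝓘(ℝ, E) y y)
      = ContinuousLinearMap.id ℝ E := by
  have h1 := (hΦ.mdifferentiableAt hs ((Φ s).map_target hy)).hasMFDerivAt.comp y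
    (hΦ.mdifferentiableAt_symm hs hy).hasMFDerivAt
  have h2 : (Φ s ∘ (Φ s).symm) =ᶠ[𝓝 y] id := by
    filter_upwards [(Φ s).open_target.mem_nhds hy] with z hz
    exact (Φ s).right_inv hz
  have h3 := hasMFDerivAt_unique (h1.congr_of_eventuallyEq h2.symm) (hasMFDerivAt_id y)
  have h4 := chartDerivInv_comp_chartDeriv hc
  rw [hΦ.fderiv_flowInChart hs hy hc]
  ext v
  have e1 := DFunLike.congr_fun h4 (mfderiv 𝓘(ℝ, E) 𝓘(ℝ, E) (Φ s).symm y v)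
  have e2 := DFunLike.congr_fun h3 v
  exact (congrArg (mfderiv 𝓘(ℝ, E) 𝓘(ℝ, E) (Φ s) ((Φ s).symm y)) e1).trans e2

theorem IsLocalFlow.comp_flowDerivInv (hΦ : IsLocalFlow J X Φ) {s : ℝ} (hs : s ∈ J) {y c : M}
    (hy : y ∈ (Φ s).target) (hc : (Φ s).symm y ∈ (extChartAt 𝓘(ℝ, E) c).source) :
    fderiv ℝ (fun z => flowInChart Φ c y (s, z)) (extChartAt 𝓘(ℝ, E) y y)
      ∘L flowDerivInv Φ c y s = ContinuousLinearMap.id ℝ E := by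
  have h1 := hasMFDerivAt_comp_of_eq
    (hΦ.mdifferentiableAt_symm hs hy).hasMFDerivAt
    (hΦ.mdifferentiableAt hs ((Φ s).map_target hy)).hasMFDerivAt ((Φ s).right_inv hy)
  have h2 : ((Φ s).symm ∘ Φ s) =ᶠ[𝓝 ((Φ s).symm y)] id := by
    filter_upwards [(Φ s).open_source.mem_nhds ((Φ s).map_target hy)] with z hz
    exact (Φ s).left_inv hz
  have h1' : HasMFDerivAt 𝓘(ℝ, E) 𝓘(ℝ, E) id ((Φ s).symm y) _ := h1.congr_of_eventuallyEq h2.symm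
  have h3 := hasMFDerivAt_unique h1' (hasMFDerivAt_id ((Φ s).symm y))
  have h4 := chartDeriv_comp_chartDerivInv hc
  rw [hΦ.fderiv_flowInChart hs hy hc]
  ext v
  have e2 := DFunLike.congr_fun h3 (chartDerivInv c ((Φ s).symm y) v)
  have e1 := DFunLike.congr_fun h4 v
  exact (congrArg (chartDeriv c ((Φ s).symm y)) e2).trans e1

/-- The chart differential in the local expression of `π` cancels against the inverse one in
`flowDerivInv`. The centre `c` need not be `(Φ s).symm y`, so one chart serves all `s` near a given
time. -/
theorem pushPair_eq (π : BivectorField E M) {s : ℝ} {y c : M}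
    (hc : (Φ s).symm y ∈ (extChartAt 𝓘(ℝ, E) c).source) (μ ν : E →L[ℝ] ℝ) :
    pushPair (Φ s) π ((Φ s).symm y) μ ν
      = ν (flowDerivInv Φ c y s (BivectorField.inChart π c
          (extChartAt 𝓘(ℝ, E) c ((Φ s).symm y)) (μ ∘L flowDerivInv Φ c y s))) := by
  have h := chartDerivInv_comp_chartDeriv hc
  rw [bivector_inChart_apply π hc]
  have e1 : (μ ∘L flowDerivInv Φ c y s) ∘L (chartDeriv c ((Φ s).symm y) : E →L[ℝ] E)
      = μ ∘L (mfderiv 𝓘(ℝ, E) 𝓘(ℝ, E) (Φ s) ((Φ s).symm y) : E →L[ℝ] E) := by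
    ext v
    exact congrArg (fun w : E => μ ((mfderiv 𝓘(ℝ, E) 𝓘(ℝ, E) (Φ s) ((Φ s).symm y) : E →L[ℝ] E) w))
      (DFunLike.congr_fun h v)
  have e2 := DFunLike.congr_fun h ((π ((Φ s).symm y)).sharp
    (μ ∘L (mfderiv 𝓘(ℝ, E) 𝓘(ℝ, E) (Φ s) ((Φ s).symm y) : E →L[ℝ] E)))
  have e3 := congrArg (fun w : E =>
    ν ((mfderiv 𝓘(ℝ, E) 𝓘(ℝ, E) (Φ s) ((Φ s).symm y) : E →L[ℝ] E) w)) e2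
  refine e3.symm.trans ?_
  rw [← e1]
  rfl

end Flow

/-! ### Vanishing of the derivative of `(Φ_s)_* π_s`. -/

section Main

variable {E : Type*} [NormedAddCommGroup E] [NormedSpace ℝ E]
  {M : Type*} [TopologicalSpace M] [ChartedSpace E M] {J I : Set ℝ}
  {Φ : ℝ → OpenPartialHomeomorph M M} {V : Set M}

theorem IsLocalFlow.continuousWithinAt {X : ℝ → VecField E M} (hΦ : IsLocalFlow J X Φ)
    (hIJ : I ⊆ J) (hV : ∀ s ∈ I, V ⊆ (Φ s).target) {s₀ : ℝ} (hs₀ : s₀ ∈ I) {y : M} (hy : y ∈ V) :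
    ContinuousWithinAt (fun s => (Φ s).symm y) I s₀ :=
  ContinuousWithinAt.comp (f := fun s : ℝ => (s, y)) (g := fun p : ℝ × M => (Φ p.1).symm p.2)
    (hΦ.smooth_symm (s₀, y) ⟨hIJ hs₀, hV s₀ hs₀ hy⟩).continuousWithinAt
    (continuousWithinAt_id.prodMk continuousWithinAt_const) (fun s hs => ⟨hIJ hs, hV s hs hy⟩)

theorem pushPair_zero {X : ℝ → VecField E M} (hΦ : IsLocalFlow J X Φ) (π : BivectorField E M)
    {y : M} (hy : y ∈ (Φ 0).target) (μ ν : E →L[ℝ] ℝ) :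
    pushPair (Φ 0) π ((Φ 0).symm y) μ ν = (π y : Bivector E).pair μ ν := by
  have hid : ∀ z ∈ (Φ 0).target, Φ 0 z = z := fun z hz => by
    conv_lhs => rw [← hΦ.zero z hz]
    exact (Φ 0).right_inv hz
  have h1 : Φ 0 =ᶠ[𝓝 y] id := by
    filter_upwards [(Φ 0).open_target.mem_nhds hy] with z hz
    exact hid z hz
  have h2 : (mfderiv 𝓘(ℝ, E) 𝓘(ℝ, E) (Φ 0) y : E →L[ℝ] E) = ContinuousLinearMap.id ℝ E :=
    ((hasMFDerivAt_id y).congr_of_eventuallyEq h1).mfderiv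
  rw [hΦ.zero y hy, pushPair, h2]
  rfl

variable [IsManifold 𝓘(ℝ, E) ∞ M] [FiniteDimensional ℝ E] [T2Space M]

/-- The flow equation in the chart around `c = Φ_{s₀}⁻¹(y)`. -/
theorem IsLocalFlow.eventually_hasDerivWithinAt_flowInChart
    {π : ℝ → BivectorField E M} {a : ℝ → DiffForm E M 1}
    (hΦ : IsLocalFlow J (fun t x => (π t x).sharp (covector (a t x))) Φ) (hIJ : I ⊆ J)
    (hVo : IsOpen V) (hV : ∀ s ∈ I, V ⊆ (Φ s).target) {s₀ : ℝ} (hs₀ : s₀ ∈ I) {y c : M}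
    (hy : y ∈ V) (hc : (Φ s₀).symm y = c) :
    ∀ᶠ z in 𝓝 (extChartAt 𝓘(ℝ, E) y y),
      HasDerivWithinAt (fun s => flowInChart Φ c y (s, z))
        (sharpFieldInChart (π s₀) (a s₀) c (flowInChart Φ c y (s₀, z))) I s₀ := by
  -- For `z` near the centre, the flow at time `s₀` lands in `U`, where the chart components are
  -- germs of global test functions.
  obtain ⟨U, hUo, hcU, hUs, hU⟩ := exists_smooth_extension (E := E) c
  have h0 : (extChartAt 𝓘(ℝ, E) y).symm (extChartAt 𝓘(ℝ, E) y y) = y := extChartAt_to_inv y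
  have hcont : ContinuousAt (extChartAt 𝓘(ℝ, E) y).symm (extChartAt 𝓘(ℝ, E) y y) :=
    continuousAt_extChartAt_symm y
  have h1 : ∀ᶠ z in 𝓝 (extChartAt 𝓘(ℝ, E) y y), (extChartAt 𝓘(ℝ, E) y).symm z ∈ V :=
    hcont (by rw [h0]; exact hVo.mem_nhds hy)
  have h2 : ∀ᶠ w in 𝓝 y, (Φ s₀).symm w ∈ U :=
    (Φ s₀).continuousAt_symm (hV s₀ hs₀ hy) (by rw [hc]; exact hUo.mem_nhds hcU)
  have h3 : ∀ᶠ z in 𝓝 (extChartAt 𝓘(ℝ, E) y y), (Φ s₀).symm ((extChartAt 𝓘(ℝ, E) y).symm z) ∈ U :=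
    hcont (by rw [h0]; exact h2)
  filter_upwards [h1, h3] with z hzV hzU
  have h4 := hasDerivWithinAt_extChartAt_of_functions hUo hUs hU
    (hΦ.continuousWithinAt hIJ hV hs₀ hzV) hzU
    (fun f hf => (hΦ.deriv f hf s₀ (hIJ hs₀) _ (hV s₀ hs₀ hzV)).mono
      (fun s hs => ⟨hIJ hs, hV s hs hzV⟩))
  rw [← sharp_inChart (π s₀) (a s₀) (hUs hzU)] at h4
  exact h4

theorem hasDerivWithinAt_pushPair {π : ℝ → BivectorField E M} {Ω : ℝ → DiffForm E M 2}
    {a : ℝ → DiffForm E M 1} (hπ : SmoothBivectorFamily J π) (ha : SmoothFormFamily J a)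
    (hπ_poisson : ∀ t ∈ J, IsPoisson (π t))
    (h_gauge : ∀ t ∈ J, IsGaugeTransform (π 0) (Ω t) (π t))
    (hΩ_deriv : ∀ t ∈ J, ∀ (x : M) (v : Fin 2 → TangentSpace 𝓘(ℝ, E) x),
      HasDerivWithinAt (fun s => Ω s x v) (-(DiffForm.d (a t) x v)) J t)
    (hΦ : IsLocalFlow J (fun t x => (π t x).sharp (covector (a t x))) Φ)
    (hIJ : I ⊆ J) (hI : UniqueDiffOn ℝ I) (hVo : IsOpen V) (hV : ∀ s ∈ I, V ⊆ (Φ s).target)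
    {s₀ : ℝ} (hs₀ : s₀ ∈ I) (hs₀' : s₀ ∈ closure (interior I)) {y : M} (hy : y ∈ V)
    (μ ν : E →L[ℝ] ℝ) :
    HasDerivWithinAt (fun s => pushPair (Φ s) (π s) ((Φ s).symm y) μ ν) 0 I s₀ := by
  -- The chart is chosen anew for each `s₀`, so that the point reached at time `s₀` is its centre.
  obtain ⟨c, hc⟩ : ∃ c, (Φ s₀).symm y = c := ⟨_, rfl⟩
  have hcs : (Φ s₀).symm y ∈ (extChartAt 𝓘(ℝ, E) c).source := hc ▸ mem_extChartAt_source _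
  have hcont := hΦ.continuousWithinAt hIJ hV hs₀ hy
  have hsource : ∀ᶠ s in 𝓝[I] s₀, (Φ s).symm y ∈ (extChartAt 𝓘(ℝ, E) c).source :=
    hcont (extChartAt_source_mem_nhds' hcs)
  have hflow := hΦ.eventually_hasDerivWithinAt_flowInChart hIJ hVo hV hs₀ hy hc
  have hx₀ : flowInChart Φ c y (s₀, extChartAt 𝓘(ℝ, E) y y) = extChartAt 𝓘(ℝ, E) c c := by
    rw [flowInChart_self, hc]
  have hB := hasDerivWithinAt_fderiv_of_flow hI hs₀ hs₀'
    ((continuousOn_extChartAt_symm (I := 𝓘(ℝ, E)) y).isOpen_inter_preimage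
      (isOpen_extChartAt_target y) hVo)
    ⟨mem_extChartAt_target y, by rwa [mem_preimage, extChartAt_to_inv]⟩
    (hΦ.contDiffWithinAt_flowInChart hIJ hV hs₀ hy hcs)
    (by rw [hx₀]; exact differentiableAt_sharpFieldInChart hπ ha (hIJ hs₀) c) hflow
  rw [hx₀] at hB
  have hγ := hflow.self_of_nhds
  rw [hx₀] at hγ
  simp only [flowInChart_self] at hγ
  obtain ⟨p', hp, hp'⟩ := exists_hasDerivWithinAt_bivector_inChart hIJ hI hπ ha hπ_poisson h_gauge
    hΩ_deriv hs₀ c (γ := fun s => extChartAt 𝓘(ℝ, E) c ((Φ s).symm y)) (by rw [hc]) hγ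
    (hsource.mono fun s hs => (extChartAt 𝓘(ℝ, E) c).map_source hs)
  have hmain := hasDerivWithinAt_transport_zero hs₀ (C := flowDerivInv Φ c y) hB
    (by
      filter_upwards [hsource, self_mem_nhdsWithin] with s hs hsI
      exact hΦ.comp_flowDerivInv (hIJ hsI) (hV s hsI hy) hs)
    (by
      filter_upwards [hsource, self_mem_nhdsWithin] with s hs hsI
      exact hΦ.flowDerivInv_comp (hIJ hsI) (hV s hsI hy) hs) hp hp' μ ν
  refine hmain.congr_of_eventuallyEq ?_ (pushPair_eq (π s₀) hcs μ ν)
  filter_upwards [hsource] with s hs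
  exact pushPair_eq (π s) hs μ ν

end Main
end PoissonMoser

end

/-! ### Constancy on the interval between `0` and `t`. -/

theorem mainTheorem9
    {E : Type*} [NormedAddCommGroup E] [NormedSpace ℝ E] [FiniteDimensional ℝ E]
    {M : Type*} [TopologicalSpace M] [ChartedSpace E M] [IsManifold 𝓘(ℝ, E) ∞ M] [T2Space M]
    (J : Set ℝ) (hJ : J.OrdConnected) (hJ0 : (0 : ℝ) ∈ J)
    (π : ℝ → PoissonMoser.BivectorField E M)
    (Ω : ℝ → PoissonMoser.DiffForm E M 2)
    (a : ℝ → PoissonMoser.DiffForm E M 1)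
    (hπ_smooth : PoissonMoser.SmoothBivectorFamily J π)
    (hΩ_smooth : PoissonMoser.SmoothFormFamily J Ω)
    (ha_smooth : PoissonMoser.SmoothFormFamily J a)
    (hπ_poisson : ∀ t ∈ J, PoissonMoser.IsPoisson (π t))
    (hΩ_closed : ∀ t ∈ J, ∀ x : M, PoissonMoser.DiffForm.d (Ω t) x = 0)
    (h_gauge : ∀ t ∈ J, PoissonMoser.IsGaugeTransform (π 0) (Ω t) (π t))
    (hΩ_deriv : ∀ t ∈ J, ∀ (x : M) (v : Fin 2 → TangentSpace 𝓘(ℝ, E) x),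
      HasDerivWithinAt (fun s => Ω s x v) (-(PoissonMoser.DiffForm.d (a t) x v)) J t)
    (Φ : ℝ → OpenPartialHomeomorph M M)
    (hΦ : PoissonMoser.IsLocalFlow J
      (fun t x => (π t x).sharp (PoissonMoser.covector (a t x))) Φ) :
    ∀ t ∈ J, PoissonMoser.PushForwardEq (Φ t) (π t) (π 0) := by
  intro t ht x hx
  have hy : Φ t x ∈ (Φ t).target := (Φ t).map_source hx
  have hIJ : uIcc 0 t ⊆ J := hJ.uIcc_subset hJ0 ht
  have hV : ∀ s ∈ uIcc 0 t, (Φ t).target ⊆ (Φ s).target := hΦ.target_subset t ht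
  have hpair : ∀ μ ν : E →L[ℝ] ℝ, PoissonMoser.pushPair (Φ t) (π t) x μ ν
      = (π 0 (Φ t x) : PoissonMoser.Bivector E).pair μ ν := by
    intro μ ν
    rw [← PoissonMoser.pushPair_zero hΦ (π 0) (hV 0 left_mem_uIcc hy) μ ν]
    conv_lhs => rw [← (Φ t).left_inv hx]
    -- For `t = 0` the interval is a single point, where derivatives are not unique.
    rcases eq_or_ne t 0 with rfl | ht0
    · rfl
    have hne : min 0 t < max 0 t := min_lt_max.2 ht0.symm
    have hd : ∀ s ∈ uIcc 0 t, HasDerivWithinAt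
        (fun s => PoissonMoser.pushPair (Φ s) (π s) ((Φ s).symm (Φ t x)) μ ν) 0 (uIcc 0 t) s := fun s hs =>
      PoissonMoser.hasDerivWithinAt_pushPair hπ_smooth ha_smooth hπ_poisson h_gauge hΩ_deriv hΦ hIJ
        (uniqueDiffOn_Icc hne) (Φ t).open_target hV hs
        (by rw [uIcc, interior_Icc, closure_Ioo hne.ne]; exact hs) hy μ ν
    -- The mean value inequality with derivative bound `0` says that the pairing is constant.
    have := (convex_uIcc (0 : ℝ) t).norm_image_sub_le_of_norm_hasDerivWithin_le
      (C := 0) hd (by simp) left_mem_uIcc right_mem_uIcc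
    rw [zero_mul, norm_le_zero_iff, sub_eq_zero] at this
    exact this
  -- A bivector is determined by its pairings, since covectors separate vectors.
  have hsharp : ∀ p q : PoissonMoser.Bivector E, (∀ μ ν, p.pair μ ν = q.pair μ ν) → p = q := by
    rintro ⟨p, hp⟩ ⟨q, hq⟩ h
    have : p = q := by
      ext1 μ
      exact (SeparatingDual.eq_iff_forall_dual_eq (R := ℝ)).2 fun ν => h μ ν
    subst this
    rfl
  exact hsharp _ _ hpair
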